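/- All rings are commutative. Let $(A,\mathfrak m,k)$ be a noetherian local ring. An $A$-module $M$ of finite type is called a \emph{test module} for $A$ if, for every local homomorphism of noetherian local rings $A\to B$ and every $B$-module $N$ of finite type such that $\operatorname{Tor}_i^A(M,N)=0$ for all $i\gg 0$, the flat dimension $\operatorname{fd}_A(N)$ of $N$ over $A$ is finite. A local homomorphism of noetherian local rings $(A,\mathfrak m,k)\to(A',\mathfrak m',k')$ is called \emph{weakly regular} if it is flat and its closed fibre $A'\otimes_A k$ is a regular local ring. Let $(A,\mathfrak m,k)\to(A',\mathfrak m',k')$ be a weakly regular homomorphism of noetherian local rings. If $M$ is a test module for $A$, then $A'\otimes_A M$ is a test module for $A'$. -/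

import Mathlib

open CategoryTheory TensorProduct

universe u

/-- `HasFlatDimensionLE A n N`: the `A`-module `N` has flat dimension at most `n`, i.e. there is an
exact sequence `0 → Fₙ → ⋯ → F₁ → F₀ → N → 0` with all `Fᵢ` flat over `A`. The sequence is encoded
one step at a time: `F₀ → N` is surjective with `F₀` flat, and its kernel has a flat resolution
of length at most `n - 1`. -/
def HasFlatDimensionLE (A : Type u) [CommRing A] :
    ℕ → (N : Type u) → [AddCommGroup N] → [Module A N] → Prop
  | 0, N, _, _ => Module.Flat A N
  | n + 1, N, _, _ =>
      ∃ (F : Type u) (_ : AddCommGroup F) (_ : Module A F) (f : F →ₗ[A] N),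
        Module.Flat A F ∧ Function.Surjective f ∧ HasFlatDimensionLE A n (LinearMap.ker f)

/-- The flat dimension of `N` over `A` is finite. -/
def HasFiniteFlatDimension (A : Type u) [CommRing A] (N : Type u) [AddCommGroup N] [Module A N] :
    Prop :=
  ∃ n : ℕ, HasFlatDimensionLE A n N

/-- `Tor_i^A(M, N) = 0` for all sufficiently large `i`. Here `Tor_i^A(M, N)` is the homology of
`P ⊗ N` for a projective resolution `P` of `M`. -/
def TorEventuallyZero (A : Type u) [CommRing A] (M N : Type u) [AddCommGroup M] [Module A M]
    [AddCommGroup N] [Module A N] : Prop :=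
  ∃ n : ℕ, ∀ i : ℕ, n ≤ i →
    Limits.IsZero (((Tor' (ModuleCat.{u} A) i).obj (ModuleCat.of A M)).obj (ModuleCat.of A N))

/-- `M` is a test module for the noetherian local ring `A`: it is of finite type and, for every
local homomorphism `A → B` of noetherian local rings and every `B`-module `N` of finite type
(regarded as an `A`-module through `A → B`), if `Tor_i^A(M, N) = 0` for all `i ≫ 0`, then `N` has
finite flat dimension over `A`. -/
structure IsTestModule (A : Type u) [CommRing A] [IsLocalRing A] [IsNoetherianRing A]
    (M : Type u) [AddCommGroup M] [Module A M] : Prop where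
  finite : Module.Finite A M
  test : ∀ (B : Type u) [CommRing B] [IsLocalRing B] [IsNoetherianRing B] [Algebra A B]
    [IsLocalHom (algebraMap A B)]
    (N : Type u) [AddCommGroup N] [Module B N] [Module A N] [IsScalarTower A B N]
    [Module.Finite B N],
    TorEventuallyZero A M N → HasFiniteFlatDimension A N

/-- The homomorphism `A → A'` of noetherian local rings is weakly regular: it is local and flat, and
its closed fibre `A' ⊗ k`, where `k` is the residue field of `A`, is a regular local ring. -/
structure IsWeaklyRegular (A A' : Type u) [CommRing A] [IsLocalRing A] [IsNoetherianRing A]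
    [CommRing A'] [IsLocalRing A'] [IsNoetherianRing A'] [Algebra A A'] : Prop where
  isLocalHom : IsLocalHom (algebraMap A A')
  flat : Module.Flat A A'
  regular : IsRegularLocalRing (A' ⊗[A] IsLocalRing.ResidueField A)

/-!
Write `N⋆` for the character module `Hom_ℤ(N, ℚ/ℤ)`. It turns `Tor` into `Ext`, since
`Extⁱ(M, N⋆) = Torᵢ(M, N)⋆`, and the flat dimension of `N` into the injective dimension of `N⋆`;
moreover `Extⁱ` over `A'` of `A' ⊗ M` with values in `N⋆` is `Extⁱ` over `A` of `M`, because
`A → A'` is flat. So it suffices to show that `fd_A N < ∞` implies `fd_{A'} N < ∞`.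

Assume that `N⋆` has finite injective dimension over `A`. Taking `M = k` shows that `Extⁱ` over `A'`
of the closed fibre `A' ⊗ k` with values in `N⋆` vanishes for large `i`. Dividing the closed fibre
successively by the elements of a regular system of parameters, one reaches `k'`, so that
`Extⁿ(k', N⋆) = 0` for some `n > 0`. By Nakayama's lemma over `B`, no element of `𝔪'` can act
injectively on a nonzero `Extⁿ(L, N⋆) = Torₙ(L, N)⋆` with `L` finite. Noetherian induction on ideals
therefore gives `Extⁿ(A' / I, N⋆) = 0` for all `I`, and `N⋆` has finite injective dimension over
`A'` by Baer's criterion.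
-/

open Abelian

section Exactness

variable {R : Type*} [CommRing R] {M₁ M₂ M₃ : Type*} [AddCommGroup M₁] [Module R M₁]
  [AddCommGroup M₂] [Module R M₂] [AddCommGroup M₃] [Module R M₃]
  {f : M₁ →ₗ[R] M₂} {g : M₂ →ₗ[R] M₃}

theorem exact_characterModule_dual (h : Function.Exact f g) :
    Function.Exact (CharacterModule.dual g) (CharacterModule.dual f) := by
  intro c
  constructor
  · intro hc
    let c' := g.toAddMonoidHom.rangeRestrict.liftOfSurjective
      g.toAddMonoidHom.rangeRestrict_surjective ⟨c, fun m hm => by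
        obtain ⟨l, rfl⟩ := (h m).1 (congrArg Subtype.val hm)
        exact DFunLike.congr_fun hc l⟩
    obtain ⟨ψ, hψ⟩ := CharacterModule.dual_surjective_of_injective g.range.subtype
      g.range.subtype_injective c'
    refine ⟨ψ, AddMonoidHom.ext fun m => ?_⟩
    exact (DFunLike.congr_fun hψ ⟨g m, m, rfl⟩).trans
      (AddMonoidHom.liftOfRightInverse_comp_apply _ _ _ _ m)
  · rintro ⟨ψ, rfl⟩
    ext l
    exact (congrArg ψ (h.apply_apply_eq_zero l)).trans (map_zero ψ)

theorem exact_of_exact_characterModule_dual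
    (h : Function.Exact (CharacterModule.dual g) (CharacterModule.dual f)) :
    Function.Exact f g := by
  refine LinearMap.exact_iff.2 (le_antisymm (fun m hm => ?_) (LinearMap.range_le_ker_iff.2 ?_))
  · rw [← Submodule.Quotient.mk_eq_zero]
    refine CharacterModule.eq_zero_of_character_apply fun c => ?_
    obtain ⟨ψ, hψ⟩ := (h (CharacterModule.dual f.range.mkQ c)).1 <| by
      rw [← LinearMap.comp_apply, ← CharacterModule.dual_comp, LinearMap.range_mkQ_comp,
        CharacterModule.dual_zero, LinearMap.zero_apply]
    exact (DFunLike.congr_fun hψ m).symm.trans ((congrArg ψ hm).trans (map_zero ψ))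
  · ext l
    exact CharacterModule.eq_zero_of_character_apply fun c =>
      DFunLike.congr_fun (h.apply_apply_eq_zero c) l

theorem exact_rTensor_iff_exact_lcomp_characterModule (N : Type*) [AddCommGroup N] [Module R N] :
    Function.Exact (f.rTensor N) (g.rTensor N) ↔
      Function.Exact (g.lcomp R (CharacterModule N)) (f.lcomp R (CharacterModule N)) := by
  have := Function.Exact.iff_of_ladder_linearEquiv
    (f₁₂ := g.lcomp R (CharacterModule N)) (f₂₃ := f.lcomp R (CharacterModule N))
    (g₁₂ := CharacterModule.dual (g.rTensor N)) (g₂₃ := CharacterModule.dual (f.rTensor N))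
    (e₁ := CharacterModule.homEquiv) (e₂ := CharacterModule.homEquiv)
    (e₃ := CharacterModule.homEquiv)
    (by rw [← CharacterModule.dual_rTensor_conj_homEquiv]; ext; simp)
    (by rw [← CharacterModule.dual_rTensor_conj_homEquiv]; ext; simp)
  exact ⟨fun h => this.1 (exact_characterModule_dual h),
    fun h => exact_of_exact_characterModule_dual (this.2 h)⟩

end Exactness

section Ext

variable {C : Type*} [Category* C] [Abelian C] [HasExt C] {X Y : C}

theorem subsingleton_ext_succ_iff (P : ProjectiveResolution X) (n : ℕ) :
    Subsingleton (Ext X Y (n + 1)) ↔ ∀ f : P.complex.X (n + 1) ⟶ Y,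
      P.complex.d (n + 2) (n + 1) ≫ f = 0 → ∃ g, P.complex.d (n + 1) n ≫ g = f := by
  refine ⟨fun _ f hf => ?_, fun h => subsingleton_of_forall_eq 0 fun e => ?_⟩
  · exact (P.extMk_eq_zero_iff f (n + 2) rfl hf n rfl).1 (Subsingleton.elim _ _)
  · obtain ⟨f, hf, rfl⟩ := P.extMk_surjective e (n + 2) rfl
    exact (P.extMk_eq_zero_iff f (n + 2) rfl hf n rfl).2 (h f hf)

variable {S : ShortComplex C} (hS : S.ShortExact) (Y)
include hS

theorem extClass_comp_mk₀_eq_zero_iff (f : S.X₁ ⟶ Y) :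
    hS.extClass.comp (Ext.mk₀ f) (add_zero 1) = 0 ↔ ∃ g : S.X₂ ⟶ Y, S.f ≫ g = f := by
  constructor
  · intro h
    obtain ⟨x, hx⟩ := Ext.contravariant_sequence_exact₁ hS Y (Ext.mk₀ f) rfl h
    obtain ⟨g, rfl⟩ := Ext.addEquiv₀.symm.surjective x
    exact ⟨g, Ext.addEquiv₀.symm.injective (by simpa using hx)⟩
  · rintro ⟨g, rfl⟩
    simp [← Ext.mk₀_comp_mk₀, hS.extClass_comp_assoc]

theorem subsingleton_ext_one_iff_extClass_comp_mk₀_eq_zero [Projective S.X₂] :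
    Subsingleton (Ext S.X₃ Y 1) ↔
      ∀ f : S.X₁ ⟶ Y, hS.extClass.comp (Ext.mk₀ f) (add_zero 1) = 0 := by
  refine ⟨fun _ f => Subsingleton.elim _ _, fun h => subsingleton_of_forall_eq 0 fun e => ?_⟩
  obtain ⟨x, rfl⟩ := Ext.contravariant_sequence_exact₃ hS Y e (Ext.eq_zero_of_projective _)
    (n₀ := 0) rfl
  obtain ⟨f, rfl⟩ := Ext.addEquiv₀.symm.surjective x
  exact h f

theorem subsingleton_ext_add_two_iff [Projective S.X₂] (n : ℕ) :
    Subsingleton (Ext S.X₃ Y (n + 2)) ↔ Subsingleton (Ext S.X₁ Y (n + 1)) := by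
  constructor
  · intro _
    refine subsingleton_of_forall_eq 0 fun e => ?_
    obtain ⟨x, rfl⟩ := Ext.contravariant_sequence_exact₁ hS Y e (n₁ := n + 2) (by omega)
      (Subsingleton.elim _ _)
    rw [Ext.eq_zero_of_projective x, Ext.comp_zero]
  · intro _
    refine subsingleton_of_forall_eq 0 fun e => ?_
    obtain ⟨x, rfl⟩ := Ext.contravariant_sequence_exact₃ hS Y e (Ext.eq_zero_of_projective _)
      (n₀ := n + 1) (by omega)
    rw [Subsingleton.elim x 0, Ext.comp_zero]

end Ext

section ModuleExt

variable {R : Type u} [CommRing R] {M₁ M₂ M₃ : Type u} [AddCommGroup M₁] [Module R M₁]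
  [AddCommGroup M₂] [Module R M₂] [AddCommGroup M₃] [Module R M₃]
  {f : M₁ →ₗ[R] M₂} {g : M₂ →ₗ[R] M₃}
  (h : Function.Exact f g) (hf : Function.Injective f) (hg : Function.Surjective g)
include h hf hg

theorem shortExact_of_exact :
    (ModuleCat.shortComplexOfCompEqZero f g h.linearMap_comp_eq_zero).ShortExact :=
  ModuleCat.shortComplex_shortExact _ h hf hg

variable (E : Type u) [AddCommGroup E] [Module R E]

theorem extClass_comp_mk₀_ofHom_eq_zero_iff (φ : M₁ →ₗ[R] E) :
    (shortExact_of_exact h hf hg).extClass.comp (Ext.mk₀ (ModuleCat.ofHom φ)) (add_zero 1) = 0 ↔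
      ∃ ψ : M₂ →ₗ[R] E, ψ ∘ₗ f = φ := by
  rw [extClass_comp_mk₀_eq_zero_iff]
  simp [ModuleCat.homEquiv.exists_congr_left, ModuleCat.hom_ext_iff, ModuleCat.homEquiv]

theorem exists_comp_eq_of_isSMulRegular {x : R}
    (hx : IsSMulRegular (Ext (ModuleCat.of R M₃) (ModuleCat.of R E) 1) x) (φ : M₁ →ₗ[R] E)
    (hφ : ∃ ψ : M₂ →ₗ[R] E, ψ ∘ₗ f = x • φ) : ∃ ψ : M₂ →ₗ[R] E, ψ ∘ₗ f = φ := by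
  rw [← extClass_comp_mk₀_ofHom_eq_zero_iff h hf hg] at hφ ⊢
  refine hx.right_eq_zero_of_smul ?_
  rwa [← Ext.comp_smul, ← Ext.mk₀_smul]

variable [Module.Projective R M₂]

theorem subsingleton_ext_one_iff_of_exact :
    Subsingleton (Ext (ModuleCat.of R M₃) (ModuleCat.of R E) 1) ↔
      ∀ φ : M₁ →ₗ[R] E, ∃ ψ : M₂ →ₗ[R] E, ψ ∘ₗ f = φ := by
  simp only [← extClass_comp_mk₀_ofHom_eq_zero_iff h hf hg]
  refine (subsingleton_ext_one_iff_extClass_comp_mk₀_eq_zero _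
    (shortExact_of_exact h hf hg)).trans ?_
  exact ModuleCat.homEquiv.forall_congr_left

theorem subsingleton_ext_add_two_iff_of_exact (n : ℕ) :
    Subsingleton (Ext (ModuleCat.of R M₃) (ModuleCat.of R E) (n + 2)) ↔
      Subsingleton (Ext (ModuleCat.of R M₁) (ModuleCat.of R E) (n + 1)) :=
  subsingleton_ext_add_two_iff _ (shortExact_of_exact h hf hg) n

theorem isSMulRegular_ext_of_add_two {n : ℕ} {x : R}
    (hx : IsSMulRegular (Ext (ModuleCat.of R M₃) (ModuleCat.of R E) (n + 2)) x) :
    IsSMulRegular (Ext (ModuleCat.of R M₁) (ModuleCat.of R E) (n + 1)) x := by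
  have hS := shortExact_of_exact h hf hg
  refine .of_injective
    (hS.extClass.precompOfLinear R (.of R E) (by omega : 1 + (n + 1) = n + 2)) ?_ hx
  refine (injective_iff_map_eq_zero _).2 fun e he => ?_
  obtain ⟨y, rfl⟩ := Ext.contravariant_sequence_exact₁ hS _ e (by omega) he
  rw [Ext.eq_zero_of_projective y, Ext.comp_zero]

end ModuleExt

theorem isZero_tor'_succ_iff {A : Type u} [CommRing A] (M N : Type u) [AddCommGroup M] [Module A M]
    [AddCommGroup N] [Module A N] (n : ℕ) :
    Limits.IsZero (((Tor' (ModuleCat.{u} A) (n + 1)).obj (.of A M)).obj (.of A N)) ↔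
      Subsingleton (Ext (ModuleCat.of A M) (ModuleCat.of A (CharacterModule N)) (n + 1)) := by
  let P := projectiveResolution (ModuleCat.of A M)
  let F := (MonoidalCategory.tensoringRight (ModuleCat.{u} A)).obj (.of A N)
  let d (n : ℕ) := (P.complex.d (n + 1) n).hom
  trans Function.Exact ((d (n + 1)).rTensor N) ((d n).rTensor N)
  · refine (P.isoLeftDerivedObj F (n + 1)).isZero_iff.trans ?_
    rw [HomologicalComplex.homologyFunctor_obj, ← HomologicalComplex.exactAt_iff_isZero_homology,
      HomologicalComplex.exactAt_iff' _ (n + 2) (n + 1) n (by simp) (by simp),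
      ShortComplex.ShortExact.moduleCat_exact_iff_function_exact]
    rfl
  · rw [exact_rTensor_iff_exact_lcomp_characterModule, subsingleton_ext_succ_iff P]
    refine ⟨fun h f hf => ?_, fun h f => ⟨fun hf => ?_, ?_⟩⟩
    · obtain ⟨g, hg⟩ := (h f.hom).1 (congrArg ModuleCat.Hom.hom hf)
      exact ⟨ModuleCat.ofHom g, ModuleCat.hom_ext hg⟩
    · obtain ⟨g, hg⟩ := h (ModuleCat.ofHom f) (ModuleCat.hom_ext hf)
      exact ⟨g.hom, congrArg ModuleCat.Hom.hom hg⟩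
    · rintro ⟨g, rfl⟩
      exact (congrArg (g ∘ₗ ModuleCat.Hom.hom ·) (P.complex.d_comp_d (n + 2) (n + 1) n)).trans
        (LinearMap.comp_zero g)

section FlatDimension

variable {A : Type u} [CommRing A]

theorem injective_characterModule_of_flat (F : Type u) [AddCommGroup F] [Module A F]
    [Module.Flat A F] : Injective (ModuleCat.of A (CharacterModule F)) :=
  (Module.injective_iff_injective_object A _).1
    (Module.Flat.iff_characterModule_injective.1 inferInstance)

theorem hasInjectiveDimensionLE_characterModule_ker_iff {F N : Type u} [AddCommGroup F]
    [Module A F] [AddCommGroup N] [Module A N] [Module.Flat A F] {f : F →ₗ[A] N}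
    (hf : Function.Surjective f) (n : ℕ) :
    HasInjectiveDimensionLE (ModuleCat.of A (CharacterModule f.ker)) n ↔
      HasInjectiveDimensionLE (ModuleCat.of A (CharacterModule N)) (n + 1) :=
  (shortExact_of_exact (exact_characterModule_dual (LinearMap.exact_subtype_ker_map f))
    (CharacterModule.dual_injective_of_surjective f hf)
    (CharacterModule.dual_surjective_of_injective _ f.ker.subtype_injective)
    ).hasInjectiveDimensionLT_X₃_iff n (injective_characterModule_of_flat F)

theorem hasFlatDimensionLE_iff_hasInjectiveDimensionLE (n : ℕ) (N : Type u) [AddCommGroup N]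
    [Module A N] : HasFlatDimensionLE A n N ↔
      HasInjectiveDimensionLE (ModuleCat.of A (CharacterModule N)) n := by
  induction n generalizing N with
  | zero =>
    exact Module.Flat.iff_characterModule_injective.trans <|
      (Module.injective_iff_injective_object A _).trans <|
        injective_iff_hasInjectiveDimensionLT_one
  | succ n ih =>
    constructor
    · rintro ⟨F, _, _, f, _, hf, h⟩
      exact (hasInjectiveDimensionLE_characterModule_ker_iff hf n).1 ((ih _).1 h)
    · intro h
      have hf := Finsupp.linearCombination_id_surjective A N
      exact ⟨N →₀ A, inferInstance, inferInstance, Finsupp.linearCombination A id, inferInstance,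
        hf, (ih _).2 ((hasInjectiveDimensionLE_characterModule_ker_iff hf n).2 h)⟩

end FlatDimension

section BaseChange

variable {A A' : Type u} [CommRing A] [CommRing A'] [Algebra A A']

theorem forall_exists_comp_baseChange_iff {M₁ M₂ E : Type u} [AddCommGroup M₁] [Module A M₁]
    [AddCommGroup M₂] [Module A M₂] [AddCommGroup E] [Module A' E] [Module A E]
    [IsScalarTower A A' E] (f : M₁ →ₗ[A] M₂) :
    (∀ φ : A' ⊗[A] M₁ →ₗ[A'] E, ∃ ψ : A' ⊗[A] M₂ →ₗ[A'] E, ψ ∘ₗ f.baseChange A' = φ) ↔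
      ∀ φ : M₁ →ₗ[A] E, ∃ ψ : M₂ →ₗ[A] E, ψ ∘ₗ f = φ := by
  let e (M : Type u) [AddCommGroup M] [Module A M] :=
    LinearMap.liftBaseChangeEquiv (R := A) (M := M) (N := E) A'
  have he (ψ : M₂ →ₗ[A] E) : e _ ψ ∘ₗ f.baseChange A' = e _ (ψ ∘ₗ f) := by
    ext
    simp [e]
  simp only [(e _).surjective.forall, (e _).surjective.exists, he, (e _).injective.eq_iff]

theorem exists_exact_finsupp (R : Type u) [Ring R] (M : Type u) [AddCommGroup M] [Module R M] :
    ∃ (K : Type u) (_ : AddCommGroup K) (_ : Module R K) (f : K →ₗ[R] (M →₀ R))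
      (g : (M →₀ R) →ₗ[R] M),
      Function.Exact f g ∧ Function.Injective f ∧ Function.Surjective g :=
  ⟨_, _, _, _, Finsupp.linearCombination R id, LinearMap.exact_subtype_ker_map _,
    Submodule.subtype_injective _, Finsupp.linearCombination_id_surjective R M⟩

theorem subsingleton_ext_baseChange_iff [Module.Flat A A'] (M E : Type u) [AddCommGroup M]
    [Module A M] [AddCommGroup E] [Module A' E] [Module A E] [IsScalarTower A A' E] (n : ℕ) :
    Subsingleton (Ext (ModuleCat.of A' (A' ⊗[A] M)) (ModuleCat.of A' E) (n + 1)) ↔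
      Subsingleton (Ext (ModuleCat.of A M) (ModuleCat.of A E) (n + 1)) := by
  obtain ⟨K, _, _, f, g, hk, hi, hp⟩ := exists_exact_finsupp A M
  have hp' := LinearMap.lTensor_surjective A' hp
  have hi' := Module.Flat.lTensor_preserves_injective_linearMap (M := A') _ hi
  have hk' : Function.Exact (f.baseChange A') (g.baseChange A') := lTensor_exact A' hk hp
  cases n with
  | zero =>
    exact (subsingleton_ext_one_iff_of_exact hk' hi' hp' E).trans <|
      (forall_exists_comp_baseChange_iff _).trans
        (subsingleton_ext_one_iff_of_exact hk hi hp E).symm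
  | succ n =>
    exact (subsingleton_ext_add_two_iff_of_exact hk' hi' hp' E n).trans <|
      (subsingleton_ext_baseChange_iff K E n).trans
        (subsingleton_ext_add_two_iff_of_exact hk hi hp E n).symm

theorem isScalarTower_characterModule (N : Type*) [AddCommGroup N] [Module A' N] [Module A N]
    [IsScalarTower A A' N] : IsScalarTower A A' (CharacterModule N) :=
  .of_algebraMap_smul fun r c => AddMonoidHom.ext fun x => congrArg c (algebraMap_smul A' r x)

end BaseChange

section Nakayama

open IsLocalRing

variable {A K P : Type u} [CommRing A] [AddCommGroup K] [Module A K] [AddCommGroup P] [Module A P]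
  {f : K →ₗ[A] P} {N : Type u} [AddCommGroup N] [Module A N]

theorem exists_comp_eq_iff_dual_ker_rTensor_eq_zero (φ : K →ₗ[A] CharacterModule N) :
    (∃ ψ : P →ₗ[A] CharacterModule N, ψ ∘ₗ f = φ) ↔
      CharacterModule.dual (f.rTensor N).ker.subtype (CharacterModule.homEquiv φ) = 0 := by
  refine .trans ?_ (exact_characterModule_dual
    (LinearMap.exact_subtype_ker_map (f.rTensor N)) (CharacterModule.homEquiv φ)).symm
  rw [Set.mem_range, CharacterModule.homEquiv.surjective.exists]
  refine exists_congr fun ψ => ?_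
  rw [← LinearEquiv.symm_apply_eq]
  rfl

/-- If `0 → K → P → L → 0` is exact with `P` projective, then the hypothesis says that `x` is
regular on `Ext¹(L, N⋆)` and the conclusion that `x` acts surjectively on `Tor₁(L, N)`. -/
theorem smul_surjective_ker_rTensor {x : A} (h : ∀ φ : K →ₗ[A] CharacterModule N,
    (∃ ψ : P →ₗ[A] CharacterModule N, ψ ∘ₗ f = x • φ) →
      ∃ ψ : P →ₗ[A] CharacterModule N, ψ ∘ₗ f = φ) :
    Function.Surjective (LinearMap.lsmul A (f.rTensor N).ker x) := by
  refine CharacterModule.surjective_of_dual_injective _ ((injective_iff_map_eq_zero _).2 ?_)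
  intro c hc
  obtain ⟨c, rfl⟩ := CharacterModule.dual_surjective_of_injective _
    (f.rTensor N).ker.subtype_injective c
  obtain ⟨φ, rfl⟩ := CharacterModule.homEquiv.surjective c
  rw [← exists_comp_eq_iff_dual_ker_rTensor_eq_zero]
  refine h φ ((exists_comp_eq_iff_dual_ker_rTensor_eq_zero _).2 ?_)
  rw [map_smul, map_smul, ← hc]
  rfl

theorem eq_zero_of_smul_surjective {A B T : Type*} [CommRing A] [CommRing B] [IsLocalRing B]
    [Algebra A B] [AddCommGroup T] [Module A T] [Module B T] [IsScalarTower A B T]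
    [Module.Finite B T] {x : A} (hx : algebraMap A B x ∈ maximalIdeal B)
    (h : Function.Surjective (LinearMap.lsmul A T x)) (t : T) : t = 0 := by
  refine (Submodule.mem_bot B).1 ?_
  rw [← Submodule.eq_bot_of_le_smul_of_le_jacobson_bot (maximalIdeal B) ⊤
    Module.Finite.fg_top (fun t _ => ?_) (jacobson_eq_maximalIdeal _ bot_ne_top).ge]
  · trivial
  · obtain ⟨s, rfl⟩ := h t
    rw [LinearMap.lsmul_apply, ← algebraMap_smul B x s]
    exact Submodule.smul_mem_smul hx trivial

variable {B : Type*} [CommRing B] [IsLocalRing B] [IsNoetherianRing B] [Algebra A B] [Module B N]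
  [IsScalarTower A B N] [Module.Finite B N] {x : A}

theorem rTensor_injective_of_smul_surjective_ker [Module.Finite A K]
    (hx : algebraMap A B x ∈ maximalIdeal B)
    (h : Function.Surjective (LinearMap.lsmul A (f.rTensor N).ker x)) :
    Function.Injective (f.rTensor N) := by
  let g : N ⊗[A] K →ₗ[B] N ⊗[A] P := AlgebraTensorModule.lTensor B N f
  have : Module.Finite B (N ⊗[A] K) :=
    .equiv (AlgebraTensorModule.cancelBaseChange A B B N K)
  have hg (z : K ⊗[A] N) : g (TensorProduct.comm A K N z) = 0 ↔ f.rTensor N z = 0 := by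
    rw [← (TensorProduct.comm A P N).map_eq_zero_iff]
    exact Eq.congr_left (LinearMap.congr_fun (LinearMap.lTensor_comp_comm f) z)
  refine (injective_iff_map_eq_zero _).2 fun z hz => (TensorProduct.comm A K N).map_eq_zero_iff.1 ?_
  refine congrArg Subtype.val (eq_zero_of_smul_surjective (T := g.ker) hx ?_ ⟨_, (hg z).2 hz⟩)
  rintro ⟨w, hw⟩
  obtain ⟨w, rfl⟩ := (TensorProduct.comm A K N).surjective w
  obtain ⟨s, hs⟩ := h ⟨w, (hg w).1 hw⟩
  refine ⟨⟨TensorProduct.comm A K N s, (hg _).2 s.2⟩, Subtype.ext ?_⟩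
  exact (map_smul _ _ _).symm.trans (congrArg (TensorProduct.comm A K N ∘ Subtype.val) hs)

variable [IsNoetherianRing A] {L : Type u} [AddCommGroup L] [Module A L] [Module.Finite A L]

theorem subsingleton_ext_one_of_isSMulRegular (hx : algebraMap A B x ∈ maximalIdeal B)
    (h : IsSMulRegular (Ext (ModuleCat.of A L) (ModuleCat.of A (CharacterModule N)) 1) x) :
    Subsingleton (Ext (ModuleCat.of A L) (ModuleCat.of A (CharacterModule N)) 1) := by
  obtain ⟨P, _, _, _, _, f, hf⟩ := Module.exists_finite_presentation A L
  have hk := LinearMap.exact_subtype_ker_map f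
  have hi := f.ker.subtype_injective
  have hker := smul_surjective_ker_rTensor (exists_comp_eq_of_isSMulRegular hk hi hf _ h)
  exact (subsingleton_ext_one_iff_of_exact hk hi hf _).2
    (rTensor_injective_iff_lcomp_surjective.1 (rTensor_injective_of_smul_surjective_ker hx hker))

theorem subsingleton_ext_of_isSMulRegular {n : ℕ} (hx : algebraMap A B x ∈ maximalIdeal B)
    (h : IsSMulRegular (Ext (ModuleCat.of A L) (ModuleCat.of A (CharacterModule N)) (n + 1)) x) :
    Subsingleton (Ext (ModuleCat.of A L) (ModuleCat.of A (CharacterModule N)) (n + 1)) := by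
  induction n generalizing L with
  | zero => exact subsingleton_ext_one_of_isSMulRegular hx h
  | succ n ih =>
    obtain ⟨P, _, _, _, _, f, hf⟩ := Module.exists_finite_presentation A L
    have hk := LinearMap.exact_subtype_ker_map f
    have hi := f.ker.subtype_injective
    exact (subsingleton_ext_add_two_iff_of_exact hk hi hf _ n).2
      (ih (isSMulRegular_ext_of_add_two hk hi hf _ h))

end Nakayama

section Devissage

variable {C : Type*} [Category* C] [Abelian C] [HasExt C] {Y : C} {n : ℕ}

theorem subsingleton_ext_of_retract {X X' : C} (r : Retract X X') (h : Subsingleton (Ext X' Y n)) :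
    Subsingleton (Ext X Y n) := by
  refine subsingleton_of_forall_eq 0 fun e => ?_
  rw [← e.mk₀_id_comp, ← r.retract, ← Ext.mk₀_comp_mk₀_assoc,
    Subsingleton.elim ((Ext.mk₀ r.r).comp e _) 0, Ext.comp_zero]

variable {S : ShortComplex C} (hS : S.ShortExact)
include hS

theorem subsingleton_ext_X₂ (h₁ : Subsingleton (Ext S.X₁ Y n))
    (h₃ : Subsingleton (Ext S.X₃ Y n)) : Subsingleton (Ext S.X₂ Y n) := by
  refine subsingleton_of_forall_eq 0 fun e => ?_
  obtain ⟨x, rfl⟩ := Ext.contravariant_sequence_exact₂ hS Y e (Subsingleton.elim _ _)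
  rw [Subsingleton.elim x 0, Ext.comp_zero]

theorem subsingleton_ext_X₃ (h₁ : Subsingleton (Ext S.X₁ Y n))
    (h₂ : Subsingleton (Ext S.X₂ Y (n + 1))) : Subsingleton (Ext S.X₃ Y (n + 1)) := by
  refine subsingleton_of_forall_eq 0 fun e => ?_
  obtain ⟨x, rfl⟩ := Ext.contravariant_sequence_exact₃ hS Y e (Subsingleton.elim _ _)
    (add_comm 1 n)
  rw [Subsingleton.elim x 0, Ext.comp_zero]

theorem subsingleton_ext_X₃_of_injective [Injective S.X₂] (h : Subsingleton (Ext Y S.X₁ (n + 2))) :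
    Subsingleton (Ext Y S.X₃ (n + 1)) := by
  refine subsingleton_of_forall_eq 0 fun e => ?_
  obtain ⟨x, rfl⟩ := Ext.covariant_sequence_exact₃ Y hS e rfl (Subsingleton.elim _ _)
  rw [Ext.eq_zero_of_injective x, Ext.zero_comp]

end Devissage

section Quotient

variable {R M M' : Type*} [Ring R] [AddCommGroup M] [Module R M] [AddCommGroup M'] [Module R M']
  (f : M →ₗ[R] M') (q : Submodule R M')

theorem injective_mapQ_comap :
    Function.Injective ((q.comap f).mapQ q f le_rfl) := by
  rw [← LinearMap.ker_eq_bot, Submodule.ker_mapQ, Submodule.mkQ_map_self]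

theorem exact_mapQ_factor {p : Submodule R M} (hp : p ≤ q.comap f) :
    Function.Exact (p.mapQ q f hp) (Submodule.factor (le_sup_left : q ≤ q ⊔ f.range)) := by
  rw [LinearMap.exact_iff, Submodule.range_mapQ, Submodule.factor, Submodule.ker_mapQ,
    Submodule.comap_id, Submodule.map_sup, Submodule.mkQ_map_self, bot_sup_eq]

end Quotient

section Residue

open IsLocalRing

variable {A : Type u} [CommRing A]

theorem isSMulRegular_ext_of_exact_lsmul {L L₃ E : Type u} [AddCommGroup L] [Module A L]
    [AddCommGroup L₃] [Module A L₃] [AddCommGroup E] [Module A E] {x : A} {g : L →ₗ[A] L₃}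
    (h : Function.Exact (LinearMap.lsmul A L x) g) (hx : IsSMulRegular L x)
    (hg : Function.Surjective g) {n : ℕ}
    (h₃ : Subsingleton (Ext (ModuleCat.of A L₃) (ModuleCat.of A E) n)) :
    IsSMulRegular (Ext (ModuleCat.of A L) (ModuleCat.of A E) n) x := by
  rw [isSMulRegular_iff_right_eq_zero_of_smul]
  intro e he
  have hS := shortExact_of_exact h hx hg
  obtain ⟨y, rfl⟩ := Ext.contravariant_sequence_exact₂ hS _ e (by
    rw [← he]
    trans (Ext.mk₀ (x • 𝟙 (ModuleCat.of A L))).comp e (zero_add n)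
    · rfl
    · rw [Ext.mk₀_smul, Ext.smul_comp, Ext.mk₀_id_comp])
  rw [Subsingleton.elim y 0, Ext.comp_zero]

theorem lt_sup_range_lsmul {I : Ideal A} {a : A} (ha : a ∉ I) :
    I < I ⊔ (LinearMap.lsmul A A a).range :=
  left_lt_sup.2 fun h => ha (h ⟨1, mul_one a⟩)

variable [IsNoetherianRing A] {B : Type*} [CommRing B] [IsLocalRing B] [IsNoetherianRing B]
  [Algebra A B] {N : Type u} [AddCommGroup N] [Module A N] [Module B N] [IsScalarTower A B N]
  [Module.Finite B N] {n : ℕ}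

theorem subsingleton_ext_quotient_of_isSMulRegular {I : Ideal A} {x : A}
    (hx : algebraMap A B x ∈ maximalIdeal B) (hreg : IsSMulRegular (A ⧸ I) x)
    (h : Subsingleton (Ext (ModuleCat.of A (A ⧸ I ⊔ (LinearMap.lsmul A A x).range))
      (ModuleCat.of A (CharacterModule N)) (n + 1))) :
    Subsingleton (Ext (ModuleCat.of A (A ⧸ I)) (ModuleCat.of A (CharacterModule N)) (n + 1)) := by
  have hlsmul : LinearMap.lsmul A (A ⧸ I) x = Submodule.mapQ I I (LinearMap.lsmul A A x)
      fun _ hy => I.mul_mem_left x hy := Submodule.linearMap_qext _ rfl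
  refine subsingleton_ext_of_isSMulRegular hx (isSMulRegular_ext_of_exact_lsmul ?_ hreg
    (Submodule.factor_surjective le_sup_left) h)
  rw [hlsmul]
  exact exact_mapQ_factor _ _ _

variable (B) in
theorem subsingleton_ext_quotient_of_residueField [IsLocalRing A] [IsLocalHom (algebraMap A B)]
    (h : Subsingleton (Ext (ModuleCat.of A (ResidueField A))
      (ModuleCat.of A (CharacterModule N)) (n + 1))) (I : Ideal A) :
    Subsingleton (Ext (ModuleCat.of A (A ⧸ I)) (ModuleCat.of A (CharacterModule N)) (n + 1)) := by
  induction I using WellFoundedGT.induction with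
  | ind I ih =>
  by_cases hI : I = ⊤
  · have : Subsingleton (A ⧸ I) := Ideal.Quotient.subsingleton_iff.2 hI
    exact Ext.subsingleton_of_projective _ _ _
  by_cases hprime : I.IsPrime
  · by_cases hm : I = maximalIdeal A
    · rwa [hm]
    obtain ⟨x, hx, hxI⟩ := SetLike.exists_of_lt ((le_maximalIdeal hI).lt_of_ne hm)
    refine subsingleton_ext_quotient_of_isSMulRegular (B := B)
      ((map_mem_nonunits_iff (algebraMap A B) x).2 hx)
      ((isSMulRegular_quotient_iff_mem_of_smul_mem _ _).2 fun y hy => ?_)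
      (ih _ (lt_sup_range_lsmul hxI))
    exact (hprime.mem_or_mem hy).resolve_left hxI
  · obtain ⟨a, ha, b, hb, hab⟩ := (Ideal.not_isPrime_iff.1 hprime).resolve_left hI
    let J : Ideal A := Submodule.comap (LinearMap.lsmul A A a) I
    have hJ : I < J := SetLike.lt_iff_le_and_exists.2
      ⟨fun y hy => I.mul_mem_left a hy, b, hab, hb⟩
    exact subsingleton_ext_X₂ (shortExact_of_exact (exact_mapQ_factor _ I le_rfl)
      (injective_mapQ_comap _ I) (Submodule.factor_surjective le_sup_left)) (ih J hJ)
      (ih _ (lt_sup_range_lsmul ha))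

end Residue

section Baer

variable {R : Type u} [CommRing R] {E : ModuleCat.{u} R}

theorem injective_of_subsingleton_ext_one_quotient
    (h : ∀ I : Ideal R, Subsingleton (Ext (ModuleCat.of R (R ⧸ I)) E 1)) : Injective E := by
  rw [← Module.injective_iff_injective_object R E, ← Module.Baer.iff_injective,
    Module.Baer.iff_surjective]
  exact fun I => (subsingleton_ext_one_iff_of_exact (LinearMap.exact_subtype_mkQ I)
    I.subtype_injective I.mkQ_surjective E).1 (h I)

theorem hasInjectiveDimensionLE_of_subsingleton_ext_quotient {n : ℕ}
    (h : ∀ I : Ideal R, Subsingleton (Ext (ModuleCat.of R (R ⧸ I)) E (n + 1))) :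
    HasInjectiveDimensionLE E n := by
  induction n generalizing E with
  | zero =>
    exact injective_iff_hasInjectiveDimensionLT_one.1 (injective_of_subsingleton_ext_one_quotient h)
  | succ n ih =>
    let P := (EnoughInjectives.presentation E).some
    have hS : (ShortComplex.mk P.f (Limits.cokernel.π P.f)
      (Limits.cokernel.condition P.f)).ShortExact :=
      { exact := ShortComplex.exact_cokernel P.f }
    exact (hS.hasInjectiveDimensionLT_X₃_iff n P.injective).1
      (ih fun I => subsingleton_ext_X₃_of_injective hS (h I))

end Baer

section RegularLocalRing

open IsLocalRing

theorem exists_ncard_lt_finrank_span_insert_eq_top {K V : Type*} [DivisionRing K] [AddCommGroup V]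
    [Module K V] [Module.Finite K V] {v : V} (hv : v ≠ 0) :
    ∃ T : Set V, T.Finite ∧ T.ncard < Module.finrank K V ∧
      Submodule.span K (insert v T) = ⊤ := by
  have hli : LinearIndepOn K id {v} := .singleton hv
  let b := Module.Basis.extend hli
  let S := hli.extend (Set.subset_univ _)
  have hvS : v ∈ S := hli.subset_extend _ rfl
  have hfin : S.Finite := Module.Finite.finite_basis b
  have hcard : S.ncard = Module.finrank K V := (Module.finrank_eq_nat_card_basis b).symm
  have hspan : Submodule.span K S = ⊤ :=
    (congrArg _ (Module.Basis.range_extend hli).symm).trans b.span_eq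
  refine ⟨S \ {v}, hfin.sdiff, ?_, ?_⟩
  · exact hcard ▸ Set.ncard_sdiff_singleton_lt_of_mem hvS hfin
  · rwa [Set.insert_sdiff_singleton, Set.insert_eq_of_mem hvS]

section IsLocalRing

variable {R : Type*} [CommRing R] [IsLocalRing R] [IsNoetherianRing R] {x : R}

theorem maximalIdeal_eq_bot_of_le_sq (h : maximalIdeal R ≤ maximalIdeal R ^ 2) :
    maximalIdeal R = ⊥ :=
  Submodule.eq_bot_of_le_smul_of_le_jacobson_bot (maximalIdeal R) _ (IsNoetherian.noetherian _)
    (h.trans_eq (sq _)) (jacobson_eq_maximalIdeal _ bot_ne_top).ge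

theorem isDomain_of_isPrime_span_singleton (hx : x ∈ maximalIdeal R)
    (hxp : ∀ p ∈ minimalPrimes R, x ∉ p) (hprime : (Ideal.span {x}).IsPrime) : IsDomain R := by
  obtain ⟨p, hp, hpx⟩ := Ideal.exists_minimalPrimes_le (bot_le : ⊥ ≤ Ideal.span {x})
  have : p.IsPrime := hp.1.1
  have hpsmul : p ≤ Ideal.span {x} • p := fun y hy => by
    obtain ⟨z, rfl⟩ := Ideal.mem_span_singleton.1 (hpx hy)
    exact Submodule.smul_mem_smul (Ideal.mem_span_singleton_self x)
      ((this.mem_or_mem hy).resolve_left (hxp p hp))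
  have hbot : p = ⊥ := by
    refine Submodule.eq_bot_of_le_smul_of_le_jacobson_bot _ _ (IsNoetherian.noetherian _) hpsmul ?_
    rwa [jacobson_eq_maximalIdeal _ bot_ne_top, Ideal.span_singleton_le_iff_mem]
  subst hbot
  exact .of_bot_isPrime R

variable (hx : x ∈ maximalIdeal R) (hx2 : x ∉ maximalIdeal R ^ 2)
include hx hx2

theorem exists_span_insert_eq_maximalIdeal :
    ∃ T : Set R, T.Finite ∧ T.ncard < (maximalIdeal R).spanFinrank ∧
      Ideal.span (insert x T) = maximalIdeal R := by
  have hv : (maximalIdeal R).toCotangent ⟨x, hx⟩ ≠ 0 := by rwa [Ne, Ideal.toCotangent_eq_zero]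
  obtain ⟨T, hT, hcard, hspan⟩ :=
    exists_ncard_lt_finrank_span_insert_eq_top (K := ResidueField R) hv
  obtain ⟨s, hs⟩ := (maximalIdeal R).toCotangent_surjective.hasRightInverse
  refine ⟨Subtype.val '' (s '' T), (hT.image _).image _, ?_, ?_⟩
  · rw [spanFinrank_maximalIdeal_eq_finrank_cotangentSpace]
    exact ((Set.ncard_image_le (hT.image _)).trans (Set.ncard_image_le hT)).trans_lt hcard
  · have hspan' : Submodule.span R (insert ⟨x, hx⟩ (s '' T)) = ⊤ := by
      rwa [← CotangentSpace.span_image_eq_top_iff, Set.image_insert_eq, ← Set.image_comp,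
        hs.comp_eq_id, Set.image_id]
    have := congrArg (Submodule.map (maximalIdeal R).subtype) hspan'
    rwa [Submodule.map_span, Submodule.map_top, Submodule.range_subtype,
      Set.image_insert_eq] at this

theorem spanFinrank_maximalIdeal_quotient_span_singleton_lt [IsLocalRing (R ⧸ Ideal.span {x})] :
    (maximalIdeal (R ⧸ Ideal.span {x})).spanFinrank < (maximalIdeal R).spanFinrank := by
  obtain ⟨T, hT, hcard, hspan⟩ := exists_span_insert_eq_maximalIdeal hx hx2
  rw [← map_maximalIdeal_of_surjective (Ideal.Quotient.mk (Ideal.span {x}))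
    Ideal.Quotient.mk_surjective, ← hspan, Ideal.map_span, Set.image_insert_eq,
    Ideal.Quotient.eq_zero_iff_mem.2 (Ideal.mem_span_singleton_self x), Ideal.span_insert_zero,
    hspan]
  exact ((Submodule.spanFinrank_span_le_ncard_of_finite (hT.image _)).trans
    (Set.ncard_image_le hT)).trans_lt hcard

end IsLocalRing

variable {R : Type*} [CommRing R] [IsRegularLocalRing R]

theorem isRegularLocalRing_quotient_span_singleton {x : R} (hx : x ∈ maximalIdeal R)
    (hx2 : x ∉ maximalIdeal R ^ 2) : IsRegularLocalRing (R ⧸ Ideal.span {x}) := by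
  have : Nontrivial (R ⧸ Ideal.span {x}) :=
    Ideal.Quotient.nontrivial_iff.2 fun h => hx (Ideal.span_singleton_eq_top.1 h)
  have : IsLocalRing (R ⧸ Ideal.span {x}) := .of_surjective' _ Ideal.Quotient.mk_surjective
  refine .of_spanFinrank_maximalIdeal_le _ (ENat.WithBot.add_le_add_one_right_iff.1 ?_)
  calc ((maximalIdeal (R ⧸ Ideal.span {x})).spanFinrank + 1 : WithBot ℕ∞)
      ≤ (maximalIdeal R).spanFinrank := by
        exact_mod_cast spanFinrank_maximalIdeal_quotient_span_singleton_lt hx hx2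
    _ = (maximalIdeal R).height := by
        rw [maximalIdeal_height_eq_ringKrullDim, IsRegularLocalRing.spanFinrank_maximalIdeal]
    _ ≤ ringKrullDim (R ⧸ Ideal.span {x}) + 1 := Ideal.height_le_ringKrullDim_quotient_add_one hx

theorem maximalIdeal_eq_bot_of_mem_minimalPrimes (h : maximalIdeal R ∈ minimalPrimes R) :
    maximalIdeal R = ⊥ := by
  have hrank := IsRegularLocalRing.spanFinrank_maximalIdeal (R := R)
  rw [← maximalIdeal_height_eq_ringKrullDim, Ideal.height_eq_zero_iff.2 h] at hrank
  exact (Submodule.spanFinrank_eq_zero_iff_eq_bot (IsNoetherian.noetherian _)).1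
    (by exact_mod_cast hrank)

theorem exists_mem_maximalIdeal_notMem_sq_notMem_minimalPrimes (h : maximalIdeal R ≠ ⊥) :
    ∃ x ∈ maximalIdeal R, x ∉ maximalIdeal R ^ 2 ∧ ∀ p ∈ minimalPrimes R, x ∉ p := by
  by_contra! hcover
  obtain ⟨J, hJ, hle⟩ := (Ideal.subset_union_prime_finite (f := id) (I := maximalIdeal R)
    ((minimalPrimes.finite_of_isNoetherianRing R).insert (maximalIdeal R ^ 2))
    (maximalIdeal R ^ 2) (maximalIdeal R ^ 2)
    fun J hJ hne _ => (hJ.resolve_left hne).1.1).1 fun x hx => by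
      by_cases hx2 : x ∈ maximalIdeal R ^ 2
      · exact Set.mem_biUnion (Set.mem_insert _ _) hx2
      · obtain ⟨p, hp, hxp⟩ := hcover x hx hx2
        exact Set.mem_biUnion (Set.mem_insert_of_mem _ hp) hxp
  obtain rfl | hJ := hJ
  · exact h (maximalIdeal_eq_bot_of_le_sq hle)
  · have hJm : J = maximalIdeal R := le_antisymm (le_maximalIdeal hJ.1.1.ne_top) hle
    exact h (maximalIdeal_eq_bot_of_mem_minimalPrimes (hJm ▸ hJ))

variable (R) in
theorem isDomain_of_isRegularLocalRing : IsDomain R := by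
  induction hd : (maximalIdeal R).spanFinrank using Nat.strong_induction_on generalizing R with
  | _ d ih =>
  by_cases hm : maximalIdeal R = ⊥
  · exact (isField_iff_maximalIdeal_eq.2 hm).isDomain
  obtain ⟨x, hx, hx2, hxp⟩ := exists_mem_maximalIdeal_notMem_sq_notMem_minimalPrimes hm
  have := isRegularLocalRing_quotient_span_singleton hx hx2
  have hlt := spanFinrank_maximalIdeal_quotient_span_singleton_lt hx hx2
  exact isDomain_of_isPrime_span_singleton hx hxp
    ((Ideal.Quotient.isDomain_iff_prime _).1 (ih _ (hd ▸ hlt) _ rfl))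

end RegularLocalRing

section RegularAlgebra

open IsLocalRing

variable {A R E : Type u} [CommRing A] [CommRing R] [Algebra A R]
  [AddCommGroup E] [Module A E] {n : ℕ}

theorem subsingleton_ext_quotient_span_singleton {x : R} (hx : IsLeftRegular x)
    (h : ∀ i ≥ n, Subsingleton (Ext (ModuleCat.of A R) (ModuleCat.of A E) (i + 1))) :
    ∀ i ≥ n + 1,
      Subsingleton (Ext (ModuleCat.of A (R ⧸ Ideal.span {x})) (ModuleCat.of A E) (i + 1)) := by
  have hexact : Function.Exact (LinearMap.mulLeft A x)
      (Ideal.Quotient.mkₐ A (Ideal.span {x})).toLinearMap := fun y =>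
    Ideal.Quotient.eq_zero_iff_mem.trans <| Ideal.mem_span_singleton.trans <|
      exists_congr fun _ => eq_comm
  intro i hi
  obtain ⟨i, rfl⟩ := Nat.exists_eq_add_of_le' (Nat.one_le_of_lt hi)
  exact subsingleton_ext_X₃ (shortExact_of_exact hexact hx Ideal.Quotient.mk_surjective)
    (h i (by omega)) (h (i + 1) (by omega))

variable [IsLocalRing A]

theorem subsingleton_ext_residueField_of_isField
    (hR : Function.Surjective (algebraMap A R)) (hf : IsField R)
    (h : Subsingleton (Ext (ModuleCat.of A R) (ModuleCat.of A E) n)) :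
    Subsingleton (Ext (ModuleCat.of A (ResidueField A)) (ModuleCat.of A E) n) := by
  have hker : (Algebra.linearMap A R).ker = maximalIdeal A := by
    let := hf.toField
    exact eq_maximalIdeal (RingHom.ker_isMaximal_of_surjective (algebraMap A R) hR)
  let e := (Submodule.quotEquivOfEq _ _ hker.symm).trans
    ((Algebra.linearMap A R).quotKerEquivOfSurjective hR)
  exact subsingleton_ext_of_retract e.toModuleIso.retract h

theorem exists_subsingleton_ext_residueField [IsRegularLocalRing R]
    (hR : Function.Surjective (algebraMap A R))
    (h : ∀ i ≥ n, Subsingleton (Ext (ModuleCat.of A R) (ModuleCat.of A E) (i + 1))) :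
    ∃ k, Subsingleton (Ext (ModuleCat.of A (ResidueField A)) (ModuleCat.of A E) (k + 1)) := by
  induction hd : (maximalIdeal R).spanFinrank using Nat.strong_induction_on generalizing R n with
  | _ d ih =>
  by_cases hm : maximalIdeal R = ⊥
  · exact ⟨n, subsingleton_ext_residueField_of_isField hR (isField_iff_maximalIdeal_eq.2 hm)
      (h n le_rfl)⟩
  obtain ⟨x, hx, hx2, -⟩ := exists_mem_maximalIdeal_notMem_sq_notMem_minimalPrimes hm
  have := isDomain_of_isRegularLocalRing R
  have := isRegularLocalRing_quotient_span_singleton hx hx2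
  have hlt := spanFinrank_maximalIdeal_quotient_span_singleton_lt hx hx2
  have hx0 : x ≠ 0 := fun h0 => hx2 (h0 ▸ Ideal.zero_mem _)
  exact ih _ (hd ▸ hlt) (R := R ⧸ Ideal.span {x}) (Ideal.Quotient.mk_surjective.comp hR)
    (subsingleton_ext_quotient_span_singleton (mul_right_injective₀ hx0) h) rfl

end RegularAlgebra

theorem torEventuallyZero_iff {A M N : Type u} [CommRing A] [AddCommGroup M] [Module A M]
    [AddCommGroup N] [Module A N] : TorEventuallyZero A M N ↔
      ∃ n, ∀ i ≥ n, Subsingleton (Ext (.of A M) (ModuleCat.of A (CharacterModule N)) (i + 1)) := by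
  simp only [← isZero_tor'_succ_iff]
  constructor
  · rintro ⟨n, hn⟩
    exact ⟨n, fun i hi => hn (i + 1) (by omega)⟩
  · rintro ⟨n, hn⟩
    refine ⟨n + 1, fun i hi => ?_⟩
    obtain ⟨i, rfl⟩ := Nat.exists_eq_add_of_le' (Nat.one_le_of_lt hi)
    exact hn i (by omega)

section Ascent

variable {A A' : Type u} [CommRing A] [CommRing A'] [Algebra A A']
  {N : Type u} [AddCommGroup N] [Module A' N] [Module A N] [IsScalarTower A A' N]

theorem torEventuallyZero_baseChange_iff [Module.Flat A A'] (M : Type u) [AddCommGroup M]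
    [Module A M] : TorEventuallyZero A' (A' ⊗[A] M) N ↔ TorEventuallyZero A M N := by
  have := isScalarTower_characterModule (A := A) (A' := A') N
  simp only [torEventuallyZero_iff, subsingleton_ext_baseChange_iff]

theorem hasFiniteFlatDimension_of_subsingleton_ext_residueField (B : Type*) [CommRing B]
    [IsLocalRing B] [IsNoetherianRing B] [IsLocalRing A] [IsNoetherianRing A] [Algebra A B]
    [IsLocalHom (algebraMap A B)] [Module B N] [IsScalarTower A B N] [Module.Finite B N] {n : ℕ}
    (h : Subsingleton (Ext (ModuleCat.of A (IsLocalRing.ResidueField A))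
      (ModuleCat.of A (CharacterModule N)) (n + 1))) : HasFiniteFlatDimension A N :=
  ⟨n, (hasFlatDimensionLE_iff_hasInjectiveDimensionLE n N).2
    (hasInjectiveDimensionLE_of_subsingleton_ext_quotient
      (subsingleton_ext_quotient_of_residueField B h))⟩

theorem HasFiniteFlatDimension.exists_subsingleton_ext (h : HasFiniteFlatDimension A N) :
    ∃ n, ∀ X : ModuleCat.{u} A, ∀ i ≥ n,
      Subsingleton (Ext X (ModuleCat.of A (CharacterModule N)) (i + 1)) := by
  obtain ⟨n, hn⟩ := h
  have := (hasFlatDimensionLE_iff_hasInjectiveDimensionLE n N).1 hn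
  exact ⟨n, fun X i hi => HasInjectiveDimensionLT.subsingleton _ (n + 1) _ (by omega) X⟩

variable [IsLocalRing A] [IsNoetherianRing A] [IsLocalRing A'] [IsNoetherianRing A']

theorem IsWeaklyRegular.hasFiniteFlatDimension (h : IsWeaklyRegular A A') (B : Type*) [CommRing B]
    [IsLocalRing B] [IsNoetherianRing B] [Algebra A' B] [IsLocalHom (algebraMap A' B)]
    [Module B N] [IsScalarTower A' B N] [Module.Finite B N] (hN : HasFiniteFlatDimension A N) :
    HasFiniteFlatDimension A' N := by
  have := h.flat
  have := h.regular
  have := isScalarTower_characterModule (A := A) (A' := A') N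
  obtain ⟨n, hn⟩ := hN.exists_subsingleton_ext
  have hsurj : Function.Surjective (algebraMap A' (A' ⊗[A] IsLocalRing.ResidueField A)) :=
    Algebra.TensorProduct.includeLeft_surjective A' A' IsLocalRing.residue_surjective
  have hfibre (i : ℕ) (hi : i ≥ n) :=
    (subsingleton_ext_baseChange_iff (A' := A') (IsLocalRing.ResidueField A)
      (CharacterModule N) i).2 (hn _ i hi)
  obtain ⟨k, hk⟩ := exists_subsingleton_ext_residueField hsurj hfibre
  exact hasFiniteFlatDimension_of_subsingleton_ext_residueField B hk

end Ascent

theorem lemma2p5 (A A' : Type u) [CommRing A] [IsLocalRing A] [IsNoetherianRing A]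
    [CommRing A'] [IsLocalRing A'] [IsNoetherianRing A'] [Algebra A A']
    (h : IsWeaklyRegular A A') (M : Type u) [AddCommGroup M] [Module A M]
    (hM : IsTestModule A M) :
    IsTestModule A' (A' ⊗[A] M) := by
  have := hM.finite
  have := h.isLocalHom
  have := h.flat
  refine ⟨inferInstance, fun B _ _ _ _ _ N _ _ _ _ _ hTor => ?_⟩
  let : Algebra A B := ((algebraMap A' B).comp (algebraMap A A')).toAlgebra
  let : Module A N := .compHom N (algebraMap A A')
  have : IsScalarTower A A' N := .of_algebraMap_smul fun _ _ => rfl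
  have : IsScalarTower A A' B := .of_algebraMap_eq fun _ => rfl
  have : IsScalarTower A B N := .of_algebraMap_smul fun a n => by
    rw [IsScalarTower.algebraMap_apply A A' B, algebraMap_smul, algebraMap_smul]
  have : IsLocalHom (algebraMap A B) :=
    inferInstanceAs (IsLocalHom ((algebraMap A' B).comp (algebraMap A A')))
  exact h.hasFiniteFlatDimension B (hM.test B N ((torEventuallyZero_baseChange_iff M).1 hTor))
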